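/- Let $\Omega\subset\mathbb R^d$, $d\ge 2$, be a bounded connected open set with Lipschitz boundary, and let $\Lambda_0,\Lambda\in\mathbb R$ both lie outside the spectrum of the Dirichlet Laplacian $-\Delta^{\rm Dir}$ on $\Omega$. For such $\Lambda$ the Dirichlet-to-Neumann map $\mathcal D_\Lambda:H^{1/2}(\partial\Omega)\to H^{-1/2}(\partial\Omega)$ sends $u$ to the normal derivative $\partial_n U$ of the unique weak solution $U\in H^1(\Omega)$ of $-\Delta U=\Lambda U$ in $\Omega$, $U|_{\partial\Omega}=u$; all function spaces are real, normal derivatives are defined in the weak sense through Green's formula, and $\langle\cdot,\cdot\rangle$ denotes the inner product of $L^2(\partial\Omega)$, extended to the duality pairing between $H^{-1/2}(\partial\Omega)$ and $H^{1/2}(\partial\Omega)$. Let $(v_j)_{j\ge1}\subset H^{1/2}(\partial\Omega)$ be an orthonormal basis of $L^2(\partial\Omega)$ with $\mathcal D_{\Lambda_0}v_j=\sigma_j^{(\Lambda_0)}v_j$ for all $j$, and let $(U_k^{\rm Dir})_{k\ge1}$ be an orthonormal basis of $L^2(\Omega)$ consisting of eigenfunctions of $-\Delta^{\rm Dir}$,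 with eigenvalues $\lambda_k^{\rm Dir}$. Define the semi-infinite matrices $$\mathtt D_\Lambda=\bigl(\langle\mathcal D_\Lambda v_i,v_j\rangle\bigr)_{i,j\ge1},\qquad \mathtt D_{\Lambda_0}=\bigl(\langle\mathcal D_{\Lambda_0} v_i,v_j\rangle\bigr)_{i,j\ge1},\qquad \mathtt A=\bigl(\langle v_i,\partial_nU_k^{\rm Dir}\rangle\bigr)_{i,k\ge1},\qquad \mathtt B_\Lambda=\left(\frac{\Lambda_0-\Lambda}{(\Lambda_0-\lambda_k^{\rm Dir})(\Lambda-\lambda_k^{\rm Dir})}\,\delta_{i,k}\right)_{i,k\ge1}.$$ Then the denominators in $\mathtt B_\Lambda$ do not vanish, $\mathtt D_{\Lambda_0}=\bigl(\sigma_i^{(\Lambda_0)}\delta_{i,j}\bigr)_{i,j\ge1}$ is diagonal, and $$\mathtt D_\Lambda=\mathtt D_{\Lambda_0}+\mathtt A\,\mathtt B_\Lambda\,\mathtt A^{\mathtt t},$$ where all the series defining the entries of the matrix products converge (unconditionally). -/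

import Mathlib

open MeasureTheory Set Filter
open scoped ContDiff RealInnerProductSpace

noncomputable section

namespace HelmholtzDtN

/-- `d`-dimensional Euclidean space. -/
abbrev E (d : ℕ) : Type := EuclideanSpace ℝ (Fin d)

variable {d : ℕ} {Ω : Set (E d)} {Λ : ℝ}

/-- The boundary of `Ω` is locally the graph of a Lipschitz function, with `Ω` on one side of it:
near every boundary point there are a unit vector `e` and a Lipschitz function `g` on the
hyperplane orthogonal to `e` such that `Ω` is the region `⟪e, y⟫ < g (projection of y)`. -/
def HasLipschitzBoundary (Ω : Set (E d)) : Prop :=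
  ∀ x ∈ frontier Ω, ∃ e : E d, ‖e‖ = 1 ∧ ∃ (g : (Submodule.span ℝ {e})ᗮ → ℝ) (K : NNReal),
    LipschitzWith K g ∧ ∃ r > 0, ∀ y ∈ Metric.ball x r,
      (y ∈ Ω ↔ ⟪e, y⟫ < g ((Submodule.span ℝ {e})ᗮ.orthogonalProjectionOnto y))

/-- A bounded Lipschitz domain: a bounded, connected (in particular nonempty) open set with
Lipschitz boundary. -/
structure IsBoundedLipschitzDomain (Ω : Set (E d)) : Prop where
  isOpen : IsOpen Ω
  isConnected : IsConnected Ω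
  isBounded : Bornology.IsBounded Ω
  lipschitz : HasLipschitzBoundary Ω

/-- The `(d-1)`-dimensional surface measure on `∂Ω` (Hausdorff measure, normalised so that it
agrees with Lebesgue measure on hyperplanes). -/
def surface (Ω : Set (E d)) : Measure (E d) := (μHE[d - 1] : Measure (E d)).restrict (frontier Ω)

/-- `L²(Ω)`. -/
abbrev L2 (Ω : Set (E d)) := Lp ℝ 2 (volume.restrict Ω)

/-- Square integrable vector fields on `Ω`. -/
abbrev L2Vec (Ω : Set (E d)) := Lp (E d) 2 (volume.restrict Ω)

/-- `L²(∂Ω)`. -/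
abbrev L2Bdry (Ω : Set (E d)) := Lp ℝ 2 (surface Ω)

/-- `G` is the weak (distributional) gradient of `U` in `Ω`. -/
def IsWeakGradient (Ω : Set (E d)) (U : L2 Ω) (G : L2Vec Ω) : Prop :=
  ∀ φ : E d → ℝ, ContDiff ℝ ∞ φ → HasCompactSupport φ → tsupport φ ⊆ Ω → ∀ e : E d,
    ∫ x in Ω, U x * fderiv ℝ φ x e = - ∫ x in Ω, ⟪G x, e⟫ * φ x

lemma isWeakGradient_iff (U : L2 Ω) (G : L2Vec Ω) : IsWeakGradient Ω U G ↔
    ∀ φ : E d → ℝ, ContDiff ℝ ∞ φ → HasCompactSupport φ → tsupport φ ⊆ Ω → ∀ e : E d,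
      ∀ (h₁ : MemLp (fun x => fderiv ℝ φ x e) 2 (volume.restrict Ω))
        (h₂ : MemLp (fun x => φ x • e) 2 (volume.restrict Ω)),
        ⟪h₁.toLp, U⟫ + ⟪h₂.toLp, G⟫ = 0 := by
  have key : ∀ (φ : E d → ℝ) (e : E d)
      (h₁ : MemLp (fun x => fderiv ℝ φ x e) 2 (volume.restrict Ω))
      (h₂ : MemLp (fun x => φ x • e) 2 (volume.restrict Ω)),
      ⟪h₁.toLp, U⟫ = ∫ x in Ω, U x * fderiv ℝ φ x e ∧
      ⟪h₂.toLp, G⟫ = ∫ x in Ω, ⟪G x, e⟫ * φ x := by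
    intro φ e h₁ h₂
    constructor
    · rw [L2.inner_def]
      refine integral_congr_ae ?_
      filter_upwards [h₁.coeFn_toLp] with x hx
      rw [hx]; simp
    · rw [L2.inner_def]
      refine integral_congr_ae ?_
      filter_upwards [h₂.coeFn_toLp] with x hx
      rw [hx, inner_smul_left, real_inner_comm]; simp [mul_comm]
  constructor
  · intro h φ a b c e h₁ h₂
    rw [(key φ e h₁ h₂).1, (key φ e h₁ h₂).2, h φ a b c e]; ring
  · intro h φ a b c e
    have h₁ : MemLp (fun x => fderiv ℝ φ x e) 2 (volume.restrict Ω) := by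
      refine Continuous.memLp_of_hasCompactSupport ?_ ?_
      · exact (a.continuous_fderiv (by simp)).clm_apply continuous_const
      · exact (b.fderiv (𝕜 := ℝ)).comp_left (g := fun L : E d →L[ℝ] ℝ => L e) rfl
    have h₂ : MemLp (fun x => φ x • e) 2 (volume.restrict Ω) := by
      refine Continuous.memLp_of_hasCompactSupport ?_ ?_
      · exact a.continuous.smul continuous_const
      · exact b.smul_right
    have := h φ a b c e h₁ h₂
    rw [(key φ e h₁ h₂).1, (key φ e h₁ h₂).2] at this
    linarith

/-- The Sobolev space `H¹(Ω)`, realised as the space of pairs `(U, ∇U)` in `L²(Ω) × L²(Ω)^d`, with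
the inner product `⟪U, V⟫ + ⟪∇U, ∇V⟫`. -/
def H1 (Ω : Set (E d)) : Submodule ℝ (WithLp 2 (L2 Ω × L2Vec Ω)) where
  carrier := {p | IsWeakGradient Ω p.fst p.snd}
  zero_mem' := by
    refine (isWeakGradient_iff _ _).2 fun φ _ _ _ e h₁ h₂ => ?_
    simp
  add_mem' := by
    intro p q hp hq
    refine (isWeakGradient_iff _ _).2 fun φ a b c e h₁ h₂ => ?_
    have hp := (isWeakGradient_iff _ _).1 hp φ a b c e h₁ h₂
    have hq := (isWeakGradient_iff _ _).1 hq φ a b c e h₁ h₂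
    rw [WithLp.add_fst, WithLp.add_snd, inner_add_right, inner_add_right]
    linarith
  smul_mem' := by
    intro t p hp
    refine (isWeakGradient_iff _ _).2 fun φ a b c e h₁ h₂ => ?_
    have hp := (isWeakGradient_iff _ _).1 hp φ a b c e h₁ h₂
    rw [WithLp.smul_fst, WithLp.smul_snd, inner_smul_right, inner_smul_right, ← mul_add, hp,
      mul_zero]

/-- The underlying `L²` function of an element of `H¹(Ω)`. -/
def fn (U : H1 Ω) : L2 Ω := U.1.fst

/-- The gradient of an element of `H¹(Ω)`. -/
def grad (U : H1 Ω) : L2Vec Ω := U.1.snd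

@[simp] lemma fn_add (U V : H1 Ω) : fn (U + V) = fn U + fn V := rfl
@[simp] lemma fn_sub (U V : H1 Ω) : fn (U - V) = fn U - fn V := rfl
@[simp] lemma fn_smul (t : ℝ) (U : H1 Ω) : fn (t • U) = t • fn U := rfl
@[simp] lemma fn_zero : fn (0 : H1 Ω) = 0 := rfl
@[simp] lemma grad_add (U V : H1 Ω) : grad (U + V) = grad U + grad V := rfl
@[simp] lemma grad_sub (U V : H1 Ω) : grad (U - V) = grad U - grad V := rfl
@[simp] lemma grad_smul (t : ℝ) (U : H1 Ω) : grad (t • U) = t • grad U := rfl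
@[simp] lemma grad_zero : grad (0 : H1 Ω) = 0 := rfl

lemma inner_H1 (U V : H1 Ω) : ⟪U, V⟫ = ⟪fn U, fn V⟫ + ⟪grad U, grad V⟫ := rfl

lemma isClosed_H1 : IsClosed (H1 Ω : Set (WithLp 2 (L2 Ω × L2Vec Ω))) := by
  have : (H1 Ω : Set (WithLp 2 (L2 Ω × L2Vec Ω))) = {p | ∀ φ : E d → ℝ, ContDiff ℝ ∞ φ →
      HasCompactSupport φ → tsupport φ ⊆ Ω → ∀ e : E d,
      ∀ (h₁ : MemLp (fun x => fderiv ℝ φ x e) 2 (volume.restrict Ω))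
        (h₂ : MemLp (fun x => φ x • e) 2 (volume.restrict Ω)),
        ⟪h₁.toLp, p.fst⟫ + ⟪h₂.toLp, p.snd⟫ = 0} := by
    ext p
    exact isWeakGradient_iff p.fst p.snd
  rw [this]
  simp only [ofPred_forall]
  refine isClosed_iInter fun φ => isClosed_iInter fun _ => isClosed_iInter fun _ =>
    isClosed_iInter fun _ => isClosed_iInter fun e => isClosed_iInter fun h₁ =>
    isClosed_iInter fun h₂ => isClosed_eq ?_ continuous_const
  exact (continuous_const.inner (WithLp.continuous_fst 2 _ _)).add
    (continuous_const.inner (WithLp.continuous_snd 2 _ _))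

instance : CompleteSpace (H1 Ω) := isClosed_H1.completeSpace_coe

/-- Pairs `(U, u)` where `U` is the restriction to `Ω` and `u` the restriction to `∂Ω` of one
smooth function on the whole space. -/
def smoothTraceGraph (Ω : Set (E d)) : Submodule ℝ (H1 Ω × L2Bdry Ω) where
  carrier := {p | ∃ φ : E d → ℝ, ContDiff ℝ ∞ φ ∧
    fn p.1 =ᵐ[volume.restrict Ω] φ ∧ p.2 =ᵐ[surface Ω] φ}
  zero_mem' := ⟨0, contDiff_const, Lp.coeFn_zero _ _ _, Lp.coeFn_zero _ _ _⟩
  add_mem' := by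
    rintro p q ⟨φ, h1, h2, h3⟩ ⟨ψ, k1, k2, k3⟩
    exact ⟨φ + ψ, h1.add k1, (Lp.coeFn_add _ _).trans (h2.add k2),
      (Lp.coeFn_add _ _).trans (h3.add k3)⟩
  smul_mem' := by
    rintro t p ⟨φ, h1, h2, h3⟩
    exact ⟨t • φ, h1.const_smul t, (Lp.coeFn_smul _ _).trans (h2.const_smul t),
      (Lp.coeFn_smul _ _).trans (h3.const_smul t)⟩

/-- The graph of the trace operator `U ↦ U|_{∂Ω}`, `H¹(Ω) → L²(∂Ω)`: the closure in
`H¹(Ω) × L²(∂Ω)` of the restriction map on smooth functions. (On a bounded Lipschitz domain this is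
the graph of the usual bounded trace operator.) -/
def traceGraph (Ω : Set (E d)) : Submodule ℝ (H1 Ω × L2Bdry Ω) :=
  (smoothTraceGraph Ω).topologicalClosure

/-- `u` is the boundary trace of `U`. -/
def HasTrace (U : H1 Ω) (u : L2Bdry Ω) : Prop := (U, u) ∈ traceGraph Ω

/-- `H¹₀(Ω)`, the functions of `H¹(Ω)` with zero trace on `∂Ω`. (On a bounded Lipschitz domain this
is the closure in `H¹(Ω)` of the smooth functions with compact support in `Ω`.) -/
def H10 (Ω : Set (E d)) : Submodule ℝ (H1 Ω) :=
  (traceGraph Ω).comap (LinearMap.inl ℝ (H1 Ω) (L2Bdry Ω))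

lemma mem_H10 {U : H1 Ω} : U ∈ H10 Ω ↔ HasTrace U 0 := Iff.rfl

lemma HasTrace.add {U V : H1 Ω} {u v : L2Bdry Ω} (hU : HasTrace U u) (hV : HasTrace V v) :
    HasTrace (U + V) (u + v) := (traceGraph Ω).add_mem hU hV

lemma HasTrace.sub {U V : H1 Ω} {u v : L2Bdry Ω} (hU : HasTrace U u) (hV : HasTrace V v) :
    HasTrace (U - V) (u - v) := (traceGraph Ω).sub_mem hU hV

lemma HasTrace.sub_mem {U V : H1 Ω} {u : L2Bdry Ω} (hU : HasTrace U u) (hV : HasTrace V u) :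
    U - V ∈ H10 Ω := by
  have := hU.sub hV
  rwa [sub_self] at this

instance : CompleteSpace (H10 Ω) := by
  have h : IsClosed (H10 Ω : Set (H1 Ω)) :=
    (smoothTraceGraph Ω).isClosed_topologicalClosure.preimage
      (continuous_id.prodMk continuous_const)
  exact h.completeSpace_coe

/-- `H^{1/2}(∂Ω)`, the space of traces of functions of `H¹(Ω)`, as a subspace of `L²(∂Ω)`. -/
def H12 (Ω : Set (E d)) : Submodule ℝ (L2Bdry Ω) :=
  (traceGraph Ω).map (LinearMap.snd ℝ (H1 Ω) (L2Bdry Ω))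

lemma H12.exists_lift (u : H12 Ω) : ∃ U : H1 Ω, HasTrace U u := by
  obtain ⟨⟨U, u'⟩, h, hu⟩ := u.2
  exact ⟨U, by rw [← hu]; exact h⟩

/-- `H^{-1/2}(∂Ω)`, the dual space of `H^{1/2}(∂Ω)`: the linear functionals that are bounded with
respect to the trace norm `‖u‖ = inf {‖U‖_{H¹(Ω)} : U|_{∂Ω} = u}`. The value `g u` is the duality
pairing, which extends the inner product of `L²(∂Ω)`. -/
def Hm12 (Ω : Set (E d)) : Submodule ℝ (Module.Dual ℝ (H12 Ω)) where
  carrier := {g | ∃ C : ℝ, ∀ (U : H1 Ω) (u : H12 Ω), HasTrace U u → |g u| ≤ C * ‖U‖}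
  zero_mem' := ⟨0, fun U u _ => by simp⟩
  add_mem' := by
    rintro f g ⟨C, hC⟩ ⟨D, hD⟩
    refine ⟨C + D, fun U u h => ?_⟩
    rw [add_mul]
    exact (abs_add_le _ _).trans (add_le_add (hC U u h) (hD U u h))
  smul_mem' := by
    rintro t f ⟨C, hC⟩
    refine ⟨|t| * C, fun U u h => ?_⟩
    rw [LinearMap.smul_apply, smul_eq_mul, abs_mul, mul_assoc]
    exact mul_le_mul_of_nonneg_left (hC U u h) (abs_nonneg t)

/-- `ΔU = F` weakly in `Ω`, with `U ∈ H¹(Ω)` and `F ∈ L²(Ω)`: the weak formulation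
`∫_Ω ∇U · ∇V = - ∫_Ω F V` for all `V ∈ H¹₀(Ω)`. -/
def HasLaplacian (U : H1 Ω) (F : L2 Ω) : Prop :=
  ∀ V ∈ H10 Ω, ⟪grad U, grad V⟫ = - ⟪F, fn V⟫

lemma exists_normalDeriv {U : H1 Ω} {F : L2 Ω} (h : HasLaplacian U F) :
    ∃ g : Hm12 Ω, ∀ (V : H1 Ω) (v : H12 Ω), HasTrace V v →
      g.1 v = ⟪grad U, grad V⟫ + ⟪F, fn V⟫ := by
  choose L hL using H12.exists_lift (Ω := Ω)
  have key : ∀ (V : H1 Ω) (v : H12 Ω), HasTrace V v →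
      ⟪grad U, grad (L v)⟫ + ⟪F, fn (L v)⟫ = ⟪grad U, grad V⟫ + ⟪F, fn V⟫ := by
    intro V v hV
    have := h _ ((hL v).sub_mem hV)
    rw [grad_sub, fn_sub, inner_sub_right, inner_sub_right] at this
    linarith
  refine ⟨⟨{ toFun := fun v => ⟪grad U, grad (L v)⟫ + ⟪F, fn (L v)⟫
             map_add' := ?_, map_smul' := ?_ }, ‖grad U‖ + ‖F‖, ?_⟩, fun V v hV => key V v hV⟩
  · intro v w
    rw [key (L v + L w) (v + w) ((traceGraph Ω).add_mem (hL v) (hL w)), grad_add, fn_add,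
      inner_add_right, inner_add_right]
    ring
  · intro t v
    rw [key (t • L v) (t • v) ((traceGraph Ω).smul_mem t (hL v)), grad_smul, fn_smul,
      inner_smul_right, inner_smul_right, RingHom.id_apply, smul_eq_mul, mul_add]
  · intro V v hV
    change |⟪grad U, grad (L v)⟫ + ⟪F, fn (L v)⟫| ≤ _
    rw [key V v hV, add_mul]
    have h1 : ‖fn V‖ ≤ ‖V‖ := WithLp.norm_fst_le _ V.1
    have h2 : ‖grad V‖ ≤ ‖V‖ := WithLp.norm_snd_le _ V.1
    refine (abs_add_le _ _).trans (add_le_add ?_ ?_)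
    · exact (abs_real_inner_le_norm _ _).trans (by gcongr)
    · exact (abs_real_inner_le_norm _ _).trans (by gcongr)

/-- The normal derivative `∂ₙU ∈ H^{-1/2}(∂Ω)` of a function `U ∈ H¹(Ω)` with `ΔU = F ∈ L²(Ω)`. -/
def normalDeriv {U : H1 Ω} {F : L2 Ω} (h : HasLaplacian U F) : Hm12 Ω :=
  (exists_normalDeriv h).choose

/-- The normal derivative is characterised by Green's formula
`⟨∂ₙU, V|_{∂Ω}⟩ = ∫_Ω ∇U · ∇V + ∫_Ω (ΔU) V` for all `V ∈ H¹(Ω)`. -/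
lemma normalDeriv_apply {U : H1 Ω} {F : L2 Ω} (h : HasLaplacian U F) {V : H1 Ω} {v : H12 Ω}
    (hV : HasTrace V v) : (normalDeriv h).1 v = ⟪grad U, grad V⟫ + ⟪F, fn V⟫ :=
  (exists_normalDeriv h).choose_spec V v hV

/-- The graph of the Dirichlet Laplacian: `U ∈ H¹₀(Ω)` lies in its domain and `-Δ^Dir U = F`. -/
def IsDirichletLaplacian (U : H1 Ω) (F : L2 Ω) : Prop :=
  U ∈ H10 Ω ∧ HasLaplacian U (-F)

/-- The (real) spectrum of the Dirichlet Laplacian: the real `Λ` for which `-Δ^Dir - Λ` is not a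
bijection of its domain onto `L²(Ω)`. (The operator is closed, so that the inverse of a bijection
is automatically bounded; it is self-adjoint, so that there is no non-real spectrum.) -/
def dirichletSpectrum (Ω : Set (E d)) : Set ℝ :=
  {Λ | ¬ ∀ F : L2 Ω, ∃! W : H1 Ω, IsDirichletLaplacian W (Λ • fn W + F)}

/-- `-ΔU = ΛU` weakly in `Ω`: `U` is `Λ`-harmonic. -/
def IsHarmonic (Λ : ℝ) (U : H1 Ω) : Prop := HasLaplacian U (-(Λ • fn U))

lemma IsHarmonic.add_dirichlet {U W : H1 Ω} (hU : IsHarmonic (-1) U)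
    (hW : IsDirichletLaplacian W (Λ • fn W + (Λ + 1) • fn U)) : IsHarmonic Λ (U + W) := by
  intro V hV
  have h1 := hU V hV
  have h2 := hW.2 V hV
  rw [inner_neg_left, inner_smul_left] at h1
  rw [inner_neg_left, inner_add_left, inner_smul_left, inner_smul_left] at h2
  rw [grad_add, fn_add, inner_add_left, inner_neg_left, inner_smul_left, inner_add_left]
  simp only [conj_trivial] at h1 h2 ⊢
  linear_combination h1 + h2

lemma IsHarmonic.sub {U V : H1 Ω} (hU : IsHarmonic Λ U) (hV : IsHarmonic Λ V) :
    IsHarmonic Λ (U - V) := by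
  intro W hW
  have h1 := hU W hW
  have h2 := hV W hW
  rw [inner_neg_left, inner_smul_left] at h1 h2 ⊢
  rw [grad_sub, fn_sub, inner_sub_left, inner_sub_left]
  linear_combination h1 - h2

lemma isDirichletLaplacian_zero (Λ : ℝ) :
    IsDirichletLaplacian (0 : H1 Ω) (Λ • fn (0 : H1 Ω)) := by
  refine ⟨(H10 Ω).zero_mem, fun Z _ => ?_⟩
  rw [grad_zero, fn_zero, smul_zero, neg_zero, inner_zero_left, inner_zero_left, neg_zero]

lemma exists_orthogonal_decomposition {X : Type*} [NormedAddCommGroup X] [InnerProductSpace ℝ X]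
    (K : Submodule ℝ X) [CompleteSpace K] (x : X) : ∃ p ∈ K, ∀ y ∈ K, ⟪y, x - p⟫ = 0 :=
  ⟨K.orthogonalProjectionOnto x, (K.orthogonalProjectionOnto x).2, fun y hy =>
    (Submodule.mem_orthogonal _ _).1 (K.sub_starProjection_mem_orthogonal x) y hy⟩

/-- For `Λ` outside the Dirichlet spectrum, every `u ∈ H^{1/2}(∂Ω)` has exactly one
`Λ`-harmonic extension. -/
lemma existsUnique_harmonicExtension (hΛ : Λ ∉ dirichletSpectrum Ω) (u : H12 Ω) :
    ∃! U : H1 Ω, IsHarmonic Λ U ∧ HasTrace U u := by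
  have hΛ' : ∀ F : L2 Ω, ∃! W : H1 Ω, IsDirichletLaplacian W (Λ • fn W + F) := not_not.1 hΛ
  obtain ⟨G, hG⟩ := H12.exists_lift u
  obtain ⟨P, hP, hGP⟩ := exists_orthogonal_decomposition (H10 Ω) G
  obtain ⟨U, hUt, hU⟩ : ∃ U : H1 Ω, HasTrace U u ∧ IsHarmonic (-1) U := by
    refine ⟨G - P, ?_, ?_⟩
    · have := hG.sub (mem_H10.1 hP)
      rwa [sub_zero] at this
    · intro V hV
      have h := hGP V hV
      rw [real_inner_comm, inner_H1] at h
      rw [neg_smul, one_smul, neg_neg]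
      exact eq_neg_of_add_eq_zero_right h
  obtain ⟨W, hW, -⟩ := hΛ' ((Λ + 1) • fn U)
  have hUW : HasTrace (U + W) u := by
    have := hUt.add (mem_H10.1 hW.1)
    rwa [add_zero] at this
  refine ⟨U + W, ⟨hU.add_dirichlet hW, hUW⟩, ?_⟩
  rintro V ⟨hV, hVu⟩
  have h0 := hΛ' 0
  simp only [add_zero] at h0
  have h1 : IsDirichletLaplacian (V - (U + W)) (Λ • fn (V - (U + W))) :=
    ⟨hVu.sub_mem hUW, hV.sub (hU.add_dirichlet hW)⟩
  exact sub_eq_zero.1 (h0.unique h1 (isDirichletLaplacian_zero Λ))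

/-- The `Λ`-harmonic extension `ℰ_Λ u ∈ H¹(Ω)` of `u ∈ H^{1/2}(∂Ω)`. -/
def harmonicExtension (hΛ : Λ ∉ dirichletSpectrum Ω) (u : H12 Ω) : H1 Ω :=
  (existsUnique_harmonicExtension hΛ u).choose

lemma harmonicExtension_spec (hΛ : Λ ∉ dirichletSpectrum Ω) (u : H12 Ω) :
    IsHarmonic Λ (harmonicExtension hΛ u) ∧ HasTrace (harmonicExtension hΛ u) u :=
  (existsUnique_harmonicExtension hΛ u).choose_spec.1

/-- The Dirichlet-to-Neumann map `𝒟_Λ : H^{1/2}(∂Ω) → H^{-1/2}(∂Ω)`, `u ↦ ∂ₙ(ℰ_Λ u)`. -/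
def dtn (hΛ : Λ ∉ dirichletSpectrum Ω) (u : H12 Ω) : Hm12 Ω :=
  normalDeriv (harmonicExtension_spec hΛ u).1

/-- `(v_j)` is an orthonormal basis of `L²(∂Ω)` consisting of eigenfunctions `v_j ∈ H^{1/2}(∂Ω)`
of `𝒟_Λ` with eigenvalues `σ_j`. The equation `𝒟_Λ v_j = σ_j v_j` holds in `H^{-1/2}(∂Ω)`, that
is, tested against every `w ∈ H^{1/2}(∂Ω)`. -/
structure IsDtNEigenbasis (hΛ : Λ ∉ dirichletSpectrum Ω) (v : ℕ → H12 Ω) (σ : ℕ → ℝ) : Prop where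
  orthonormal : Orthonormal ℝ (fun j => (v j : L2Bdry Ω))
  complete : (Submodule.span ℝ (range fun j => (v j : L2Bdry Ω))).topologicalClosure = ⊤
  eigen : ∀ (j : ℕ) (w : H12 Ω), (dtn hΛ (v j)).1 w = σ j * ⟪(v j : L2Bdry Ω), (w : L2Bdry Ω)⟫

/-- `(U_k)` is an orthonormal basis of `L²(Ω)` consisting of eigenfunctions of the Dirichlet
Laplacian with eigenvalues `lam_k`. -/
structure IsDirichletEigenbasis (U : ℕ → H1 Ω) (lam : ℕ → ℝ) : Prop where
  orthonormal : Orthonormal ℝ (fun k => fn (U k))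
  complete : (Submodule.span ℝ (range fun k => fn (U k))).topologicalClosure = ⊤
  eigen : ∀ k, IsDirichletLaplacian (U k) (lam k • fn (U k))

/-- The matrix of `𝒟_Λ` in the system `(v_j)`, with entries `⟨𝒟_Λ v_i, v_j⟩`. -/
def dtnMatrix (hΛ : Λ ∉ dirichletSpectrum Ω) (v : ℕ → H12 Ω) : Matrix ℕ ℕ ℝ :=
  Matrix.of fun i j => (dtn hΛ (v i)).1 (v j)

/-- The matrix with entries `⟨v_i, ∂ₙU_k⟩`. -/
def matrixA {U : ℕ → H1 Ω} {lam : ℕ → ℝ} (v : ℕ → H12 Ω) (hU : IsDirichletEigenbasis U lam) :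
    Matrix ℕ ℕ ℝ :=
  Matrix.of fun i k => (normalDeriv (hU.eigen k).2).1 (v i)

/-- The diagonal matrix with entries `(Λ₀ - Λ) / ((Λ₀ - lam_k) (Λ - lam_k))`. -/
def matrixB (Λ₀ Λ : ℝ) (lam : ℕ → ℝ) : Matrix ℕ ℕ ℝ :=
  Matrix.diagonal fun k => (Λ₀ - Λ) / ((Λ₀ - lam k) * (Λ - lam k))

/-- `P` is the product `M N` of semi-infinite matrices: every series `∑_k M_{ik} N_{kj}` converges
(unconditionally) and its sum is `P_{ij}`. -/
def IsMatrixProduct (M N P : Matrix ℕ ℕ ℝ) : Prop :=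
  ∀ i j, HasSum (fun k => M i k * N k j) (P i j)

end HelmholtzDtN

end

open HelmholtzDtN

namespace HelmholtzDtN

section

variable {d : ℕ} {Ω : Set (EuclideanSpace ℝ (Fin d))} {Λ₀ Λ : ℝ}

/-! Write `E_Λ u` for the `Λ`-harmonic extension of `u`. Green's formula turns ⟨𝒟_Λ u, v⟩ into the
bilinear form (∇·, ∇·) - Λ(·, ·) evaluated at `E_Λ u` and any extension of `v` whatsoever. This
freedom is the key: taking the extension harmonic for the other parameter makes the gradient terms
of the two maps coincide, so that their difference is (Λ₀ - Λ)(E_Λ u, E_Λ₀ v), an inner product in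
L²(Ω) (`dtn_sub_dtn`).

This inner product is expanded in the Dirichlet eigenbasis by Parseval. Green's formula between `E_Λ
u` and an eigenfunction shows that ⟨u, ∂ₙU_k⟩ is (Λ - λ_k) times the k-th Fourier coefficient of
`E_Λ u` (`normalDeriv_dirichlet_apply`). Using this with Λ for v_i and with Λ₀ for v_j, the two
divisions produce the denominator in 𝙱_Λ, and Parseval supplies the unconditional convergence. -/

/-- Green's formula for the Dirichlet-to-Neumann map, tested against an arbitrary extension. -/
lemma dtn_apply (hΛ : Λ ∉ dirichletSpectrum Ω) (u : H12 Ω) {V : H1 Ω} {v : H12 Ω}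
    (hV : HasTrace V v) :
    (dtn hΛ u).1 v = inner ℝ (grad (harmonicExtension hΛ u)) (grad V)
      - Λ * inner ℝ (fn (harmonicExtension hΛ u)) (fn V) := by
  have h := normalDeriv_apply (harmonicExtension_spec hΛ u).1 hV
  rwa [inner_neg_left, real_inner_smul_left, ← sub_eq_add_neg] at h

/-- Extending the test datum by its own `Λ`-harmonic extension makes Green's formula symmetric in
the two data. -/
lemma dtn_symm (hΛ : Λ ∉ dirichletSpectrum Ω) (u v : H12 Ω) :
    (dtn hΛ u).1 v = (dtn hΛ v).1 u := by
  rw [dtn_apply hΛ u (harmonicExtension_spec hΛ v).2,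
    dtn_apply hΛ v (harmonicExtension_spec hΛ u).2, real_inner_comm (grad _),
    real_inner_comm (fn _)]

/-- The difference of two Dirichlet-to-Neumann maps in terms of the harmonic extensions. -/
lemma dtn_sub_dtn (hΛ₀ : Λ₀ ∉ dirichletSpectrum Ω) (hΛ : Λ ∉ dirichletSpectrum Ω) (u v : H12 Ω) :
    (dtn hΛ u).1 v - (dtn hΛ₀ u).1 v =
      (Λ₀ - Λ) * inner ℝ (fn (harmonicExtension hΛ u)) (fn (harmonicExtension hΛ₀ v)) := by
  -- After the symmetry swap each map is tested against the other's harmonic extension, so both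
  -- terms contain the same gradient pairing.
  rw [dtn_symm hΛ₀ u v, dtn_apply hΛ u (harmonicExtension_spec hΛ₀ v).2,
    dtn_apply hΛ₀ v (harmonicExtension_spec hΛ u).2,
    real_inner_comm (grad (harmonicExtension hΛ u)), real_inner_comm (fn (harmonicExtension hΛ u))]
  ring

/-- The normal derivative of a Dirichlet eigenfunction, paired with `u`, gives the Fourier
coefficient of the `Λ`-harmonic extension of `u`. -/
lemma normalDeriv_dirichlet_apply (hΛ : Λ ∉ dirichletSpectrum Ω) {W : H1 Ω} {μ : ℝ}
    (hW : IsDirichletLaplacian W (μ • fn W)) (u : H12 Ω) :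
    (normalDeriv hW.2).1 u = (Λ - μ) * inner ℝ (fn (harmonicExtension hΛ u)) (fn W) := by
  obtain ⟨hh, ht⟩ := harmonicExtension_spec hΛ u
  -- `W` has zero trace, so it is an admissible test function for the harmonic extension: the
  -- gradient pairing equals Λ times the L² pairing.
  have h := hh W hW.1
  rw [inner_neg_left, real_inner_smul_left, neg_neg] at h
  rw [normalDeriv_apply hW.2 ht, inner_neg_left, real_inner_smul_left, real_inner_comm, h,
    real_inner_comm (fn W)]
  ring

/-- An eigenvalue of the Dirichlet Laplacian belongs to the Dirichlet spectrum. -/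
lemma ne_of_isDirichletLaplacian (hΛ : Λ ∉ dirichletSpectrum Ω) {W : H1 Ω} {μ : ℝ}
    (hW : IsDirichletLaplacian W (μ • fn W)) (h0 : fn W ≠ 0) : Λ ≠ μ := by
  rintro rfl
  have hu : ∀ F : L2 Ω, ∃! W : H1 Ω, IsDirichletLaplacian W (Λ • fn W + F) := not_not.1 hΛ
  -- With zero right-hand side, both `W` and `0` solve the problem, against uniqueness.
  have h := hu 0
  simp only [add_zero] at h
  exact h0 (by rw [h.unique hW (isDirichletLaplacian_zero Λ), fn_zero])

/-- Parseval's identity in a Dirichlet eigenbasis. -/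
lemma IsDirichletEigenbasis.hasSum_inner_mul_inner {U : ℕ → H1 Ω} {lam : ℕ → ℝ}
    (hU : IsDirichletEigenbasis U lam) (f g : L2 Ω) :
    HasSum (fun k => inner ℝ f (fn (U k)) * inner ℝ g (fn (U k))) (inner ℝ f g) := by
  have h := (HilbertBasis.mk hU.orthonormal hU.complete.ge).hasSum_inner_mul_inner f g
  simpa only [HilbertBasis.coe_mk, real_inner_comm] using h

lemma IsDtNEigenbasis.dtnMatrix_eq {hΛ : Λ ∉ dirichletSpectrum Ω} {v : ℕ → H12 Ω} {σ : ℕ → ℝ}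
    (hv : IsDtNEigenbasis hΛ v σ) : dtnMatrix hΛ v = Matrix.diagonal σ := by
  ext i j
  rw [dtnMatrix, Matrix.of_apply, hv.eigen, orthonormal_iff_ite.1 hv.orthonormal i j,
    Matrix.diagonal_apply, mul_ite, mul_one, mul_zero]

/-- Each series has at most one nonzero term, so convergence is immediate. -/
lemma isMatrixProduct_diagonal (M : Matrix ℕ ℕ ℝ) (b : ℕ → ℝ) :
    IsMatrixProduct M (Matrix.diagonal b) (Matrix.of fun i k => M i k * b k) := by
  intro i j
  have h := hasSum_single (f := fun k => M i k * Matrix.diagonal b k j) j fun k hk => by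
    rw [Matrix.diagonal_apply_ne _ hk, mul_zero]
  rwa [Matrix.diagonal_apply_eq] at h

end

end HelmholtzDtN

theorem theorem4p5 {d : ℕ} (hd : 2 ≤ d) {Ω : Set (EuclideanSpace ℝ (Fin d))}
    (hΩ : IsBoundedLipschitzDomain Ω) {Λ₀ Λ : ℝ}
    (hΛ₀ : Λ₀ ∉ dirichletSpectrum Ω) (hΛ : Λ ∉ dirichletSpectrum Ω)
    {v : ℕ → H12 Ω} {σ : ℕ → ℝ} (hv : IsDtNEigenbasis hΛ₀ v σ)
    {U : ℕ → H1 Ω} {lam : ℕ → ℝ} (hU : IsDirichletEigenbasis U lam) :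
    (∀ k, Λ₀ ≠ lam k ∧ Λ ≠ lam k) ∧
    dtnMatrix hΛ₀ v = Matrix.diagonal σ ∧
    ∃ AB ABAt : Matrix ℕ ℕ ℝ,
      IsMatrixProduct (matrixA v hU) (matrixB Λ₀ Λ lam) AB ∧
      IsMatrixProduct AB (matrixA v hU).transpose ABAt ∧
      dtnMatrix hΛ v = dtnMatrix hΛ₀ v + ABAt := by
  have hne : ∀ {μ : ℝ}, μ ∉ dirichletSpectrum Ω → ∀ k, μ ≠ lam k := fun hμ k =>
    ne_of_isDirichletLaplacian hμ (hU.eigen k) (hU.orthonormal.ne_zero k)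
  -- The difference of the two matrices is the witness for the triple product, so the remaining
  -- content is that its entries are the sums of the series.
  refine ⟨fun k => ⟨hne hΛ₀ k, hne hΛ k⟩, hv.dtnMatrix_eq, _, dtnMatrix hΛ v - dtnMatrix hΛ₀ v,
    isMatrixProduct_diagonal _ _, fun i j => ?_, (add_sub_cancel _ _).symm⟩
  -- The row index carries Λ and the column index Λ₀, matching the asymmetric pairing in
  -- `dtn_sub_dtn`.
  have h := (hU.hasSum_inner_mul_inner (fn (harmonicExtension hΛ (v i)))
    (fn (harmonicExtension hΛ₀ (v j)))).mul_left (Λ₀ - Λ)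
  rw [← dtn_sub_dtn hΛ₀ hΛ] at h
  refine h.congr_fun fun k => ?_
  -- Nonvanishing of both factors lets (Λ - λ_k)(Λ₀ - λ_k), coming from the two entries of
  -- `matrixA`, cancel the denominator of `matrixB`.
  have h₀ := sub_ne_zero.2 (hne hΛ₀ k)
  have h₁ := sub_ne_zero.2 (hne hΛ k)
  simp only [Matrix.of_apply, Matrix.transpose_apply, matrixA]
  rw [normalDeriv_dirichlet_apply hΛ (hU.eigen k), normalDeriv_dirichlet_apply hΛ₀ (hU.eigen k)]
  field_simp
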